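/- Let $V$ be a vector space of finite dimension $n$ over a finite field with $q$ elements. Let $K=\{k_1<\cdots<k_r\}$ with $r\ge 1$ and $L=\{\mu_1,\ldots,\mu_s\}$ with $s\ge 0$ be disjoint subsets of $\{0,1,\ldots,b-1\}$, with $|K|=r$ and $|L|=s$. Let $\mathcal F$ be a family (set) of subspaces of $V$ such that for every $A\in\mathcal F$ there is $k\in K$ with $\dim A\equiv k \pmod b$, and for all distinct $A,B\in\mathcal F$ there is $\mu\in L$ with $\dim(A\cap B)\equiv\mu\pmod b$. Assume that it is not the case that $b=2$ and $q+1$ is a power of $2$, and not the case that $q=2$ and $b=6$. For an integer $d$ with $0\le d\le n$ put $$\begin{bmatrix} n\\ d\end{bmatrix}_q=\frac{(q^n-1)(q^{n-1}-1)\cdots(q^{n-d+1}-1)}{(q^d-1)(q^{d-1}-1)\cdots(q-1)},$$ and put $\begin{bmatrix} n\\ d\end{bmatrix}_q=0$ for integers $d<0$ or $d>n$. Let $$N(n,s,r,q)=\sum_{i=s-r+1}^{s}\begin{bmatrix} n\\ i\end{bmatrix}_q .$$ Then $$|\mathcal F|\le\begin{cases} N(n,s,r,q), & \text{if } \bigl(s+k_r\le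 n \text{ and } r(s-r+1)\le b-1\bigr) \text{ or } s<k_1+r,\\[4pt] N(n,s,r,q)+\displaystyle\sum_{t=1}^{r}\begin{bmatrix} n\\ k_t\end{bmatrix}_q, & \text{otherwise.}\end{cases}$$ -/

import Mathlib

/-- The Gaussian binomial coefficient with upper index `a` and lower index `d`, at `q`:
`(q^a - 1)(q^(a-1) - 1)⋯(q^(a-d+1) - 1) / ((q^d - 1)(q^(d-1) - 1)⋯(q - 1))` for `0 ≤ d ≤ a`,
and `0` for an integer `d` outside that range. -/
def qBinom (q a : ℕ) (d : ℤ) : ℚ :=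
  if 0 ≤ d ∧ d ≤ (a : ℤ) then
    (∏ i ∈ Finset.range d.toNat, ((q : ℚ) ^ (a - i) - 1)) /
      ∏ i ∈ Finset.range d.toNat, ((q : ℚ) ^ (i + 1) - 1)
  else 0

/-- `N(n, s, r, q)`: the sum of the `r` Gaussian binomial coefficients with upper index `n` and
lower indices `s, s - 1, …, s - r + 1`. These indices are integers and may be negative. -/
def sumN (n s r q : ℕ) : ℚ :=
  ∑ i ∈ Finset.range r, qBinom q n ((s : ℤ) - (i : ℤ))

/-! Zsigmondy's theorem (`exists_prime_isPrimitiveRoot`) supplies a prime `p` modulo which `q` has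
order exactly `b`; the excluded pairs are its exceptions. Over `ZMod p`, a congruence of dimensions
modulo `b` becomes an equality of powers of `q`.

On the space of functions of a subspace `B`, take `f_A(B) = ∏_{μ ∈ L} (q^dim(A ∩ B) - q^μ)` for `A ∈
𝓕`, and `g_W(B) = ∏_{k ∈ K} (q^dim B - q^k) [W ≤ B]` for suitable `W` with `dim W ≤ s - r`. Since
`q^dim(A ∩ B)` counts the vectors of `A` in `B`, all of these lie in the span of the indicators `[U
≤ B]` with `dim U ≤ s`. The `f_A` are diagonal on `𝓕` and the `g_W` vanish there, so only
independence of the `g_W` is at stake; given it, `|𝓕|` plus the number of `W` is at most the number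
of subspaces of dimension at most `s`.

A relation among the `g_W` says that `∑_{W ≤ B} c W = 0` whenever `dim B` modulo `b` avoids `K`. If
no `dim W` is in `K`, a minimal `W` of the support gives a contradiction. Otherwise pigeonhole
(`exists_gap`) finds `s - r + 1` consecutive dimensions avoiding `K`, and
`sumBelow_eq_zero_of_above` carries the vanishing down from them to all smaller dimensions.
Discarding the `W` with dimension in `K` costs the extra sum in the second bound. -/

/-! ### Zsigmondy's theorem through values of cyclotomic polynomials -/

open Polynomial in
/-- If a prime `p` divides both `b` and the value at `q` of the `b`-th cyclotomic polynomial, then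
`q` has order `b / p ^ k` modulo `p`, the part of `b` prime to `p`. -/
theorem exists_isPrimitiveRoot_of_prime_dvd {q b p : ℕ} (hb : b ≠ 0) (hp : p.Prime) (hpb : p ∣ b)
    (hdvd : p ∣ ((cyclotomic b ℤ).eval (q : ℤ)).natAbs) :
    ∃ k m : ℕ, b = p ^ (k + 1) * m ∧ ¬ p ∣ m ∧ IsPrimitiveRoot (q : ZMod p) m := by
  have := Fact.mk hp
  obtain ⟨k, m, hm, hbm⟩ := Nat.exists_eq_pow_mul_and_not_dvd hb p hp.ne_one
  have hk : k ≠ 0 := by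
    rintro rfl
    simp at hbm
    exact hm (hbm ▸ hpb)
  obtain ⟨k, rfl⟩ := Nat.exists_eq_succ_of_ne_zero hk
  refine ⟨k, m, hbm, hm, ?_⟩
  have : NeZero (m : ZMod p) := ⟨by rwa [Ne, ZMod.natCast_eq_zero_iff]⟩
  -- In characteristic `p` the polynomials `Φ_b` and `Φ_m` have the same roots, and as `p ∤ m` these
  -- are the primitive `m`-th roots of unity.
  rw [← isRoot_cyclotomic_prime_pow_mul_iff_of_charP (k := k + 1) (p := p), ← hbm, IsRoot.def,
    ← map_cyclotomic_int, ← Int.cast_natCast, eval_intCast_map]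
  simpa using (ZMod.intCast_zmod_eq_zero_iff_dvd _ p).2 (Int.natCast_dvd.2 hdvd)

theorem dvd_sub_one_of_isPrimitiveRoot {q p m : ℕ} (hp : p.Prime) (hm : m ≠ 0)
    (h : IsPrimitiveRoot (q : ZMod p) m) : m ∣ p - 1 := by
  have := Fact.mk hp
  exact h.dvd_of_pow_eq_one _ (ZMod.pow_card_sub_one_eq_one (h.ne_zero hm))

open Polynomial in
theorem cyclotomic_eval_dvd_geom_sum {q b p : ℕ} (hq : 2 ≤ q) (hp : p.Prime) {c : ℕ} (hc : c ≠ 0)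
    (hb : b = c * p) :
    (cyclotomic b ℤ).eval (q : ℤ) ∣ ∑ i ∈ Finset.range p, ((q : ℤ) ^ c) ^ i := by
  have h := X_pow_sub_one_mul_cyclotomic_dvd_X_pow_sub_one_of_dvd ℤ (d := c) (n := b) (by
    rw [Nat.mem_properDivisors, hb]
    exact ⟨dvd_mul_right _ _, by nlinarith [hp.two_le, Nat.pos_of_ne_zero hc]⟩)
  have h' := eval_dvd (x := (q : ℤ)) h
  simp only [eval_mul, eval_sub, eval_pow, eval_X, eval_one] at h'
  rw [hb, pow_mul, ← mul_geom_sum ((q : ℤ) ^ c) p, ← hb] at h'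
  refine (mul_dvd_mul_iff_left ?_).1 h'
  have : (1 : ℤ) < (q : ℤ) ^ c := one_lt_pow₀ (by exact_mod_cast hq) hc
  omega

-- With `y = q^(b/p)`, the value `Φ_b(q)` divides `1 + y + ⋯ + y^(p-1)`. For odd `p`, `y ≡ 1` modulo
-- `p` makes this sum `≡ p` modulo `p^2`. For `p = 2`, `b` is a power of two at least 4, so `y` is a
-- square and `4 ∤ 1 + y`.
open Polynomial in
theorem sq_not_dvd_cyclotomic_eval {q b p : ℕ} (hq : 2 ≤ q) (hb : 3 ≤ b) (hp : p.Prime)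
    (hpb : p ∣ b) (hdvd : p ∣ ((cyclotomic b ℤ).eval (q : ℤ)).natAbs) :
    ¬ p ^ 2 ∣ ((cyclotomic b ℤ).eval (q : ℤ)).natAbs := by
  intro hsq
  obtain ⟨k, m, hbm, hm, hprim⟩ := exists_isPrimitiveRoot_of_prime_dvd (by omega) hp hpb hdvd
  have hm0 : m ≠ 0 := by rintro rfl; simp at hm
  have hgeom : (p : ℤ) ^ 2 ∣ ∑ i ∈ Finset.range p, ((q : ℤ) ^ (p ^ k * m)) ^ i := by
    refine dvd_trans ?_ (cyclotomic_eval_dvd_geom_sum hq hp (b := b) (c := p ^ k * m)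
      (mul_ne_zero (pow_ne_zero _ hp.ne_zero) hm0) (by rw [hbm]; ring))
    exact_mod_cast Int.natCast_dvd.2 hsq
  rcases hp.eq_two_or_odd' with rfl | hodd
  · have hm1 : m = 1 := by simpa using dvd_sub_one_of_isPrimitiveRoot hp hm0 hprim
    subst hm1
    have hk : k ≠ 0 := by rintro rfl; simp at hbm; omega
    obtain ⟨k, rfl⟩ := Nat.exists_eq_succ_of_ne_zero hk
    rw [Finset.sum_range_succ, Finset.sum_range_one] at hgeom
    simp only [mul_one, pow_zero, pow_one] at hgeom
    rw [Nat.succ_eq_add_one, show (q : ℤ) ^ 2 ^ (k + 1) = (q ^ 2 ^ k) ^ 2 by ring] at hgeom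
    generalize ((q : ℤ) ^ 2 ^ k) = z at hgeom
    rcases Int.even_or_odd' z with ⟨t, rfl | rfl⟩
    · have : (2 * t) ^ 2 = 4 * (t ^ 2) := by ring
      push_cast at hgeom
      omega
    · have : (2 * t + 1) ^ 2 = 4 * (t ^ 2 + t) + 1 := by ring
      push_cast at hgeom
      omega
  · have hy : (p : ℤ) ∣ (q : ℤ) ^ (p ^ k * m) - 1 := by
      rw [← ZMod.intCast_zmod_eq_zero_iff_dvd]
      push_cast
      rw [mul_comm, pow_mul, hprim.pow_eq_one, one_pow, sub_self]
    obtain ⟨t, ht⟩ := hy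
    have h := odd_sq_dvd_geom_sum₂_sub (R := ℤ) (a := 1) (b := t) hodd
    simp only [one_pow, mul_one] at h
    rw [← ht, add_sub_cancel] at h
    have h2 := (dvd_sub_right hgeom).1 h
    have h3 : p ^ 2 ∣ p := by exact_mod_cast h2
    have := Nat.le_of_dvd hp.pos h3
    nlinarith [hp.two_le]

-- A size estimate for `q = 2`. If `p` divides `b` exactly once, `Φ_m(2^p) = Φ_b(2) Φ_m(2)`, and
-- `Φ_b(2) = p` would make the left side too large for `p ≥ 5`; `p = 3` forces `b = 6`. If `p^2 ∣
-- b`, then `Φ_b(2) = Φ_{b/p}(2^p) > 2^p - 1 ≥ p`.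
open Polynomial in
theorem cyclotomic_eval_two_ne_prime {b p k m : ℕ} (hb6 : b ≠ 6) (hp : p.Prime)
    (hbm : b = p ^ (k + 1) * m) (hm : ¬ p ∣ m) (hprim : IsPrimitiveRoot ((2 : ℕ) : ZMod p) m) :
    ((cyclotomic b ℤ).eval ((2 : ℕ) : ℤ)).natAbs ≠ p := by
  intro hN
  have := Fact.mk hp
  have hm0 : m ≠ 0 := by rintro rfl; simp at hm
  have hm1 : m ≠ 1 := by
    rintro rfl
    have h := hprim.pow_eq_one
    rw [pow_one] at h
    have h' : (1 : ZMod p) = 0 := by push_cast at h; linear_combination h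
    exact one_ne_zero h'
  have hp2 : p ≠ 2 := by
    rintro rfl
    have := dvd_sub_one_of_isPrimitiveRoot hp hm0 hprim
    exact hm1 (by simpa using this)
  have h2p : p < 2 ^ p := Nat.lt_two_pow_self
  rcases k with _ | k
  · have hp3 : p ≠ 3 := by
      rintro rfl
      have := Nat.le_of_dvd (by norm_num) (dvd_sub_one_of_isPrimitiveRoot hp hm0 hprim)
      have : m = 2 := by omega
      subst this
      exact hb6 (by rw [hbm]; norm_num)
    have hp5 : 5 ≤ p := by
      by_contra hlt
      have := hp.two_le
      interval_cases p <;> first | omega | exact absurd hp (by norm_num)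
    have hexp := congrArg (eval (2 : ℝ)) (cyclotomic_expand_eq_cyclotomic_mul hp hm ℝ)
    rw [expand_eval, eval_mul] at hexp
    have hb : m * p = b := by rw [hbm]; ring
    have hval : eval (2 : ℝ) (cyclotomic (m * p) ℝ) = p := by
      rw [hb, ← map_cyclotomic_int]
      have h : (cyclotomic b ℤ).eval ((2 : ℕ) : ℤ) = p := by
        rw [← hN, Int.natAbs_of_nonneg]
        exact cyclotomic_nonneg _ (by norm_num)
      have h' := eval_intCast_map (Int.castRingHom ℝ) (cyclotomic b ℤ) ((2 : ℕ) : ℤ)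
      rw [Int.cast_id, h] at h'
      simpa using h'
    rw [hval] at hexp
    have hlow := sub_one_pow_totient_le_cyclotomic_eval (n := m) (q := (2 : ℝ) ^ p)
      (one_lt_pow₀ (by norm_num) hp.ne_zero)
    have hupp := cyclotomic_eval_le_add_one_pow_totient (n := m) (q := (2 : ℝ)) (by norm_num)
    have h3p : (p : ℝ) * 3 ≤ 2 ^ p - 1 := by
      have : ∀ t : ℕ, 5 ≤ t → t * 3 + 1 ≤ 2 ^ t := by
        intro t ht
        induction t, ht using Nat.le_induction with
        | base => norm_num
        | succ t ht ih => rw [pow_succ]; omega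
      have h := this p hp5
      have h' : (p : ℝ) * 3 + 1 ≤ 2 ^ p := by exact_mod_cast h
      linarith
    have hφ : m.totient ≠ 0 := (Nat.totient_pos.2 (Nat.pos_of_ne_zero hm0)).ne'
    have hφ1 : m.totient ≠ 1 ∨ m = 2 := by
      rw [Ne, Nat.totient_eq_one_iff]
      tauto
    have hpR : (5 : ℝ) ≤ p := by exact_mod_cast hp5
    rcases hφ1 with hφ1 | rfl
    · have hlt : (p : ℝ) < p ^ m.totient := by
        calc (p : ℝ) = p ^ 1 := (pow_one _).symm
          _ < p ^ m.totient := pow_lt_pow_right₀ (by linarith) (by omega)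
      have h1 : (p : ℝ) ^ m.totient * 3 ^ m.totient ≤ p * 3 ^ m.totient := by
        rw [← mul_pow]
        calc ((p : ℝ) * 3) ^ m.totient ≤ (2 ^ p - 1) ^ m.totient := by gcongr
          _ ≤ _ := hlow
          _ = _ := hexp
          _ ≤ p * (2 + 1) ^ m.totient := by gcongr
          _ = _ := by norm_num
      have := le_of_mul_le_mul_right h1 (by positivity)
      linarith
    · rw [cyclotomic_two] at hexp
      simp only [eval_add, eval_X, eval_one] at hexp
      linarith
  · have hexp := congrArg (eval ((2 : ℕ) : ℤ))
      (cyclotomic_expand_eq_cyclotomic hp (n := p ^ (k + 1) * m)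
        ((dvd_pow_self p k.succ_ne_zero).mul_right m) ℤ)
    have hb : p ^ (k + 1) * m * p = b := by rw [hbm]; ring
    rw [expand_eval, hb] at hexp
    have hc : 1 < p ^ (k + 1) * m :=
      lt_of_lt_of_le (by omega : 1 < m) (Nat.le_mul_of_pos_left m (pow_pos hp.pos _))
    have h := sub_one_lt_natAbs_cyclotomic_eval (q := 2 ^ p) hc
      (by have := hp.two_le; omega)
    push_cast at h hexp hN
    rw [hexp, hN] at h
    omega

open Polynomial in
/-- **Zsigmondy's theorem** for `q ^ b - 1`. -/
theorem exists_prime_isPrimitiveRoot {q b : ℕ} (hq : 2 ≤ q) (hb : 2 ≤ b)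
    (h₁ : ¬ ((∃ a : ℕ, q + 1 = 2 ^ a) ∧ b = 2)) (h₂ : ¬ (q = 2 ∧ b = 6)) :
    ∃ p : ℕ, p.Prime ∧ IsPrimitiveRoot (q : ZMod p) b := by
  by_contra! hno
  set N := ((cyclotomic b ℤ).eval (q : ℤ)).natAbs with hN
  have hN1 : q - 1 < N := sub_one_lt_natAbs_cyclotomic_eval (by omega) (by omega)
  have hdvd : ∀ p : ℕ, p.Prime → p ∣ N → p ∣ b := by
    intro p hp hpN
    by_contra hpb
    have := Fact.mk hp
    have : NeZero (b : ZMod p) := ⟨by rwa [Ne, ZMod.natCast_eq_zero_iff]⟩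
    refine hno p hp (isRoot_cyclotomic_iff.1 ?_)
    rw [IsRoot.def, ← map_cyclotomic_int, ← Int.cast_natCast, eval_intCast_map]
    simpa using (ZMod.intCast_zmod_eq_zero_iff_dvd _ p).2 (Int.natCast_dvd.2 hpN)
  -- Writing `b = p^(k+1) m` with `m ∣ p - 1`, every prime factor of `b` is at most `p`. Hence `N`
  -- has a single prime factor.
  have hlt : ∀ p p' : ℕ, p.Prime → p'.Prime → p ∣ N → p' ∣ N → p' ≤ p := by
    intro p p' hp hp' hpN hpN'
    obtain ⟨k, m, hbm, hm, hprim⟩ :=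
      exists_isPrimitiveRoot_of_prime_dvd (by omega) hp (hdvd p hp hpN) hpN
    have hm0 : m ≠ 0 := by rintro rfl; simp at hm
    have h := hdvd p' hp' hpN'
    rw [hbm, hp'.dvd_mul] at h
    rcases h with h | h
    · exact Nat.le_of_dvd hp.pos (hp'.dvd_of_dvd_pow h)
    · have := Nat.le_of_dvd (by have := hp.two_le; omega)
        (h.trans (dvd_sub_one_of_isPrimitiveRoot hp hm0 hprim))
      omega
  obtain ⟨p, hp, hpN⟩ := Nat.exists_prime_and_dvd (n := N) (by omega)
  have hpow := Nat.eq_prime_pow_of_unique_prime_dvd (n := N) (p := p) (by omega)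
    (fun {d} hd hdN => le_antisymm (hlt p d hp hd hpN hdN) (hlt d p hd hp hdN hpN))
  rcases Nat.lt_or_ge 2 b with hb3 | hb2
  · have hNp : N = p := by
      have h := sq_not_dvd_cyclotomic_eval hq hb3 hp (hdvd p hp hpN) hpN
      rw [← hN] at h
      generalize N.primeFactorsList.length = j at hpow
      rcases j with _ | _ | j
      · simp at hpow; omega
      · simpa using hpow
      · exact absurd (hpow ▸ pow_dvd_pow p (by omega)) h
    obtain ⟨k, m, hbm, hm, hprim⟩ :=
      exists_isPrimitiveRoot_of_prime_dvd (by omega) hp (hdvd p hp hpN) hpN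
    rcases Nat.lt_or_ge 2 q with hq3 | hq2
    -- For `q ≥ 3`: `p = N > (q - 1)^φ(b) ≥ 2^(p-1) ≥ p`, which is absurd.
    · have h := sub_one_pow_totient_lt_natAbs_cyclotomic_eval (n := b) (q := q) (by omega)
        (by omega)
      rw [← hN, hNp] at h
      have hφ : p - 1 ≤ b.totient := by
        have := Nat.totient_dvd_of_dvd (hdvd p hp hpN)
        rw [Nat.totient_prime hp] at this
        exact Nat.le_of_dvd (Nat.totient_pos.2 (by omega)) this
      have h1 : 2 ^ (p - 1) ≤ (q - 1) ^ b.totient :=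
        (Nat.pow_le_pow_right (by norm_num) hφ).trans (Nat.pow_le_pow_left (by omega) _)
      have h2 : p - 1 < 2 ^ (p - 1) := Nat.lt_two_pow_self
      omega
    · obtain rfl : q = 2 := by omega
      exact cyclotomic_eval_two_ne_prime (fun h => h₂ ⟨rfl, h⟩) hp hbm hm hprim hNp
  · obtain rfl : b = 2 := by omega
    have hp2 : p = 2 := (Nat.prime_dvd_prime_iff_eq hp Nat.prime_two).1 (hdvd p hp hpN)
    have : N = q + 1 := by
      rw [hN, cyclotomic_two]
      simp only [eval_add, eval_X, eval_one]
      omega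
    exact h₁ ⟨⟨_, by rw [← this, hpow, hp2]⟩, rfl⟩

/-! ### Counting subspaces of a given dimension -/

section Counting

open Module

variable {F V : Type*} [Field F] [AddCommGroup V] [Module F V]

/-- Linearly independent `d`-tuples are the bases of the `d`-dimensional subspaces. -/
theorem bijective_basis_subspace [FiniteDimensional F V] (d : ℕ) :
    Function.Bijective
      (fun x : (W : {W : Submodule F V // finrank F W = d}) ×
          {t : Fin d → W.1 // LinearIndependent F t} =>
        (⟨fun i => (x.2.1 i : V), x.2.2.map' x.1.1.subtype (Submodule.ker_subtype _)⟩ :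
          {v : Fin d → V // LinearIndependent F v})) := by
  have hspan : ∀ (W : {W : Submodule F V // finrank F W = d}) (t : Fin d → W.1),
      LinearIndependent F t → Submodule.span F (Set.range fun i => (t i : V)) = W.1 := by
    intro W t ht
    have h := ht.span_eq_top_of_card_eq_finrank' (by simp [W.2])
    have h' := congrArg (Submodule.map W.1.subtype) h
    rwa [Submodule.map_span, Submodule.map_subtype_top, ← Set.range_comp] at h'
  constructor
  · rintro ⟨W, t, ht⟩ ⟨W', t', ht'⟩ h
    have h1 : (fun i => (t i : V)) = fun i => (t' i : V) := congrArg Subtype.val h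
    have hW : W = W' := Subtype.ext (by rw [← hspan W t ht, ← hspan W' t' ht', h1])
    subst hW
    have ht : t = t' := funext fun i => Subtype.ext (congrFun h1 i)
    subst ht
    rfl
  · rintro ⟨v, hv⟩
    exact ⟨⟨⟨Submodule.span F (Set.range v), by rw [finrank_span_eq_card hv, Fintype.card_fin]⟩,
      ⟨fun i => ⟨v i, Submodule.subset_span ⟨i, rfl⟩⟩, linearIndependent_span hv⟩⟩, rfl⟩

theorem natCard_finrank_eq_mul [Fintype F] [FiniteDimensional F V] {d : ℕ} (hd : d ≤ finrank F V) :
    Nat.card {W : Submodule F V // finrank F W = d} *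
        ∏ i : Fin d, (Fintype.card F ^ d - Fintype.card F ^ i.val) =
      ∏ i : Fin d, (Fintype.card F ^ finrank F V - Fintype.card F ^ i.val) := by
  have : Finite V := Module.finite_of_finite F
  have : Fintype {W : Submodule F V // finrank F W = d} := Fintype.ofFinite _
  rw [← card_linearIndependent hd, ← Nat.card_eq_of_bijective _ (bijective_basis_subspace d),
    Nat.card_sigma]
  have : ∀ W : {W : Submodule F V // finrank F W = d},
      Nat.card {t : Fin d → W.1 // LinearIndependent F t} =
        ∏ i : Fin d, (Fintype.card F ^ d - Fintype.card F ^ i.val) := fun W => by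
    rw [card_linearIndependent W.2.ge, W.2]
  simp [this]

theorem cast_prod_pow_sub_pow {q n d : ℕ} (hq : 1 ≤ q) (hd : d ≤ n) :
    ((∏ i : Fin d, (q ^ n - q ^ i.val) : ℕ) : ℚ) =
      (∏ i ∈ Finset.range d, (q : ℚ) ^ i) * ∏ i ∈ Finset.range d, ((q : ℚ) ^ (n - i) - 1) := by
  rw [Fin.prod_univ_eq_prod_range (fun i => q ^ n - q ^ i), Nat.cast_prod,
    ← Finset.prod_mul_distrib]
  refine Finset.prod_congr rfl fun i hi => ?_
  have hi : i < d := Finset.mem_range.1 hi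
  rw [Nat.cast_sub (Nat.pow_le_pow_right hq (by omega)), mul_sub, ← pow_add,
    Nat.add_sub_cancel' (by omega)]
  simp

/-- The number of `d`-dimensional subspaces is the Gaussian binomial coefficient. -/
theorem natCard_finrank_eq [Fintype F] [FiniteDimensional F V] (d : ℕ) :
    (Nat.card {W : Submodule F V // finrank F W = d} : ℚ) =
      qBinom (Fintype.card F) (finrank F V) d := by
  have hq : 1 < Fintype.card F := Fintype.one_lt_card
  have hqQ : (1 : ℚ) < Fintype.card F := by exact_mod_cast hq
  rcases Nat.lt_or_ge (finrank F V) d with hd | hd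
  · have : IsEmpty {W : Submodule F V // finrank F W = d} :=
      ⟨fun W => by have := W.1.finrank_le; have := W.2; omega⟩
    rw [qBinom, if_neg (by omega)]
    simp
  · have h := congrArg (Nat.cast (R := ℚ)) (natCard_finrank_eq_mul (F := F) (V := V) hd)
    rw [Nat.cast_mul, cast_prod_pow_sub_pow hq.le le_rfl, cast_prod_pow_sub_pow hq.le hd] at h
    have hrefl := Finset.prod_range_reflect (fun i => (Fintype.card F : ℚ) ^ (i + 1) - 1) d
    have hrefl' : ∏ i ∈ Finset.range d, ((Fintype.card F : ℚ) ^ (d - i) - 1) =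
        ∏ i ∈ Finset.range d, ((Fintype.card F : ℚ) ^ (i + 1) - 1) := by
      rw [← hrefl]
      refine Finset.prod_congr rfl fun i hi => ?_
      have hi : i < d := Finset.mem_range.1 hi
      rw [show d - 1 - i + 1 = d - i by omega]
    have hne : ∏ i ∈ Finset.range d, ((Fintype.card F : ℚ) ^ (i + 1) - 1) ≠ 0 :=
      Finset.prod_ne_zero_iff.2 fun i _ => (sub_pos.2 (one_lt_pow₀ hqQ i.succ_ne_zero)).ne'
    have hne' : ∏ i ∈ Finset.range d, (Fintype.card F : ℚ) ^ i ≠ 0 :=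
      Finset.prod_ne_zero_iff.2 fun i _ => by positivity
    rw [qBinom, if_pos (by omega), Int.toNat_natCast, eq_div_iff hne]
    rw [hrefl', mul_left_comm] at h
    exact mul_left_cancel₀ hne' h

end Counting

/-! ### Vanishing passes down to smaller dimensions -/

section Descent

open Module

variable {F V 𝕜 : Type*} [Field F] [AddCommGroup V] [Module F V] [Field 𝕜]

theorem exists_submodule_ge_finrank_eq [FiniteDimensional F V] (D : Submodule F V) (j : ℕ)
    (hj : finrank F D + j ≤ finrank F V) :
    ∃ E : Submodule F V, D ≤ E ∧ finrank F E = finrank F D + j := by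
  induction j with
  | zero => exact ⟨D, le_rfl, rfl⟩
  | succ j ih =>
    obtain ⟨E, hDE, hE⟩ := ih (by omega)
    obtain ⟨v, hv⟩ : ∃ v, v ∉ E := by
      by_contra! h
      have : E = ⊤ := Submodule.eq_top_iff'.2 h
      rw [this, finrank_top] at hE
      omega
    have hlt : E < E ⊔ Submodule.span F {v} := by
      refine lt_of_le_of_ne le_sup_left fun h => hv ?_
      rw [h]
      exact Submodule.mem_sup_right (Submodule.mem_span_singleton_self v)
    have h1 := Submodule.finrank_lt_finrank_of_lt hlt
    have h2 := Submodule.finrank_add_le_finrank_add_finrank E (Submodule.span F {v})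
    have h3 : finrank F (Submodule.span F {v}) ≤ 1 :=
      (finrank_span_le_card ({v} : Set V)).trans (by simp)
    exact ⟨_, hDE.trans hlt.le, by omega⟩

theorem natCard_eq_card_pow_finrank (F M : Type*) [Field F] [Fintype F] [AddCommMonoid M]
    [Module F M] [Module.Finite F M] : Nat.card M = Fintype.card F ^ finrank F M := by
  let _ : AddCommGroup M := Module.addCommMonoidToAddCommGroup F
  rw [← Nat.card_eq_fintype_card]
  exact Module.natCard_eq_pow_finrank

theorem span_range_eq_top_iff_linearIndependent [FiniteDimensional F V] {t : ℕ}
    (hV : finrank F V = t) (v : Fin t → V) :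
    Submodule.span F (Set.range v) = ⊤ ↔ LinearIndependent F v :=
  ⟨fun h => linearIndependent_of_top_le_span_of_card_eq_finrank (le_of_eq h.symm) (by simp [hV]),
    fun h => h.span_eq_top_of_card_eq_finrank' (by simp [hV])⟩

/-- The subspace of `E` cut out by a tuple of linear functionals on `E`, as a subspace of `V`. -/
def commonKernel {E : Submodule F V} {T : Submodule F (Dual F E)} {t : ℕ} (φ : Fin t → T) :
    Submodule F V :=
  ((Submodule.span F (Set.range φ)).map T.subtype).dualCoannihilator.map E.subtype

theorem le_commonKernel_iff {E : Submodule F V} {T : Submodule F (Dual F E)} {t : ℕ}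
    (φ : Fin t → T) (W : Submodule F V) :
    W ≤ commonKernel φ ↔
      W ≤ E ∧ ∀ i, φ i ∈ (W.comap E.subtype).dualAnnihilator.comap T.subtype := by
  have key : W.comap E.subtype ≤
      ((Submodule.span F (Set.range φ)).map T.subtype).dualCoannihilator ↔
      ∀ i, φ i ∈ (W.comap E.subtype).dualAnnihilator.comap T.subtype := by
    rw [← Submodule.le_dualAnnihilator_iff_le_dualCoannihilator, Submodule.map_le_iff_le_comap,
      Submodule.span_le, Set.range_subset_iff]
    rfl
  rw [← key, commonKernel]
  constructor
  · intro h
    refine ⟨h.trans (Submodule.map_subtype_le _ _), ?_⟩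
    have := Submodule.comap_mono (f := E.subtype) h
    rwa [Submodule.comap_map_eq_of_injective E.injective_subtype] at this
  · rintro ⟨hWE, h⟩
    rw [← Submodule.map_comap_eq_of_le (f := E.subtype) (p := W) (by simpa using hWE)]
    exact Submodule.map_mono h

/-- By duality, subspaces of `T` correspond to subspaces between `D` and `E`, and `D` itself
corresponds to all of `T`. -/
theorem commonKernel_eq_iff [FiniteDimensional F V] {D E : Submodule F V} (hDE : D ≤ E)
    {T : Submodule F (Dual F E)} (hT : T = (D.comap E.subtype).dualAnnihilator) {t : ℕ}
    (φ : Fin t → T) : commonKernel φ = D ↔ Submodule.span F (Set.range φ) = ⊤ := by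
  have hD : D = (D.comap E.subtype).map E.subtype :=
    (Submodule.map_comap_eq_of_le (by simpa using hDE)).symm
  have hinj := Submodule.map_injective_of_injective T.injective_subtype
  rw [← hinj.eq_iff, Submodule.map_subtype_top]
  conv_lhs => rw [hD]
  rw [commonKernel, (Submodule.map_injective_of_injective E.injective_subtype).eq_iff]
  constructor
  · intro h
    exact Subspace.dualCoannihilator_dualAnnihilator_eq.symm.trans
      ((congrArg Submodule.dualAnnihilator h).trans hT.symm)
  · intro h
    rw [h, hT]
    exact Subspace.dualAnnihilator_dualCoannihilator_eq

/-- The annihilator of `W` in the dual of `E` has codimension at most `dim W < dim T`, so it meets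
`T` nontrivially. This keeps the base `q^0` out of the exponential sum. -/
theorem one_le_finrank_comap_dualAnnihilator [FiniteDimensional F V] {E W : Submodule F V}
    {T : Submodule F (Dual F E)} (h : finrank F W < finrank F T) :
    1 ≤ finrank F ((W.comap E.subtype).dualAnnihilator.comap T.subtype) := by
  set A := (W.comap E.subtype).dualAnnihilator
  have h1 : finrank F (A.comap T.subtype) = finrank F (T ⊓ A : Submodule F (Dual F E)) := by
    rw [← Submodule.map_comap_subtype]
    exact (Submodule.finrank_map_subtype_eq T _).symm
  have h2 := Submodule.finrank_sup_add_finrank_inf_eq T A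
  have h3 : finrank F (T ⊔ A : Submodule F (Dual F E)) ≤ finrank F E :=
    (Submodule.finrank_le _).trans_eq Subspace.dual_finrank_eq
  have h4 := Subspace.finrank_add_finrank_dualAnnihilator_eq (W.comap E.subtype)
  have h5 : finrank F (W.comap E.subtype) ≤ finrank F W := by
    rw [← Submodule.finrank_map_subtype_eq E (W.comap E.subtype)]
    exact Submodule.finrank_mono (Submodule.map_comap_le _ _)
  change finrank F (W.comap E.subtype) + finrank F A = _ at h4
  omega

/-- The function `B ↦ ∑ c W` over the subspaces `W` of `B`. -/
noncomputable def sumBelow [Fintype (Submodule F V)] (c : Submodule F V → 𝕜) (B : Submodule F V) :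
    𝕜 :=
  open scoped Classical in ∑ W, if W ≤ B then c W else 0

open scoped Classical in
/-- Summing `sumBelow c` over the common kernels of `t`-tuples of functionals gives an exponential
sum in `t`. -/
theorem sum_sumBelow_commonKernel [Fintype (Submodule F V)] (c : Submodule F V → 𝕜)
    {E : Submodule F V} {T : Submodule F (Dual F E)} [Fintype T] (t : ℕ) :
    ∑ φ : Fin t → T, sumBelow c (commonKernel φ) =
      ∑ W, if W ≤ E then
        c W * (Nat.card ((W.comap E.subtype).dualAnnihilator.comap T.subtype) : 𝕜) ^ t else 0 := by
  simp only [sumBelow]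
  rw [Finset.sum_comm]
  refine Finset.sum_congr rfl fun W _ => ?_
  simp only [le_commonKernel_iff]
  split_ifs with hWE
  · simp only [hWE, true_and]
    rw [← Finset.sum_filter, Finset.sum_const, nsmul_eq_mul, mul_comm]
    congr 1
    rw [← Nat.cast_pow, Nat.card_eq_fintype_card, Fintype.card_subtype,
      ← Fintype.card_piFinset_const]
    congr 2
    ext φ
    simp
  · simp [hWE]

open Polynomial in
/-- The downward step: a combination of the functions `B ↦ [W ≤ B]` with `dim W ≤ m` which vanishes
on all dimensions `dim D + 1, …, dim D + m + 1` vanishes at `D`. -/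
theorem sumBelow_eq_zero_of_above [Fintype F] [FiniteDimensional F V] [Fintype (Submodule F V)]
    {m : ℕ} (hQ : (Fintype.card F : 𝕜) ≠ 0)
    (hQi : ∀ i, 1 ≤ i → i ≤ m + 1 → (Fintype.card F : 𝕜) ^ i ≠ 1)
    {c : Submodule F V → 𝕜} (hc : ∀ W : Submodule F V, m < finrank F W → c W = 0) {D : Submodule F V}
    (hD : finrank F D + (m + 1) ≤ finrank F V)
    (h : ∀ B : Submodule F V, finrank F D < finrank F B → finrank F B ≤ finrank F D + (m + 1) →
      sumBelow c B = 0) :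
    sumBelow c D = 0 := by
  classical
  obtain ⟨E, hDE, hE⟩ := exists_submodule_ge_finrank_eq D (m + 1) hD
  obtain ⟨T, hT⟩ : ∃ T, T = (D.comap E.subtype).dualAnnihilator := ⟨_, rfl⟩
  have hTdim : finrank F T = m + 1 := by
    have h1 := Subspace.finrank_add_finrank_dualAnnihilator_eq (D.comap E.subtype)
    have h2 := Submodule.finrank_map_subtype_eq E (D.comap E.subtype)
    rw [Submodule.map_comap_eq_of_le (by simpa using hDE)] at h2
    rw [hT]
    omega
  have : Finite V := Module.finite_of_finite F
  have : Finite T := Module.finite_of_finite F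
  have : Fintype T := Fintype.ofFinite T
  set Q : 𝕜 := (Fintype.card F : 𝕜) with hQdef
  have hDB : ∀ {t : ℕ} (φ : Fin t → T), D ≤ commonKernel φ := by
    intro t φ
    refine (le_commonKernel_iff φ D).2 ⟨hDE, fun i => ?_⟩
    rw [← hT]
    exact (φ i).2
  have hzero : ∀ {t : ℕ} (φ : Fin t → T), commonKernel φ ≠ D → sumBelow c (commonKernel φ) = 0 := by
    intro t φ hφ
    refine h _ (Submodule.finrank_lt_finrank_of_lt (lt_of_le_of_ne (hDB φ) (Ne.symm hφ))) ?_
    rw [← hE]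
    exact Submodule.finrank_mono ((le_commonKernel_iff φ _).1 le_rfl).1
  -- Fewer than `dim T` functionals cannot span `T`, so their kernel is strictly larger than `D`.
  have hsmall : ∀ t, t < m + 1 → ∑ φ : Fin t → T, sumBelow c (commonKernel φ) = 0 := by
    intro t ht
    refine Finset.sum_eq_zero fun φ _ => hzero φ fun hφ => ?_
    have h1 := (commonKernel_eq_iff hDE hT φ).1 hφ
    have h2 := finrank_range_le_card (R := F) φ
    rw [Set.finrank, h1, finrank_top, hTdim, Fintype.card_fin] at h2
    omega
  have hlarge : ∑ φ : Fin (m + 1) → T, sumBelow c (commonKernel φ) =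
      (Nat.card {φ : Fin (m + 1) → T // LinearIndependent F φ} : 𝕜) * sumBelow c D := by
    have h1 : ∀ φ : Fin (m + 1) → T, sumBelow c (commonKernel φ) =
        if LinearIndependent F φ then sumBelow c D else 0 := by
      intro φ
      have h2 : commonKernel φ = D ↔ LinearIndependent F φ := by
        exact (commonKernel_eq_iff hDE hT φ).trans
          (span_range_eq_top_iff_linearIndependent (F := F) (V := T) hTdim φ)
      split_ifs with hφ
      · rw [h2.2 hφ]
      · exact hzero φ (mt h2.1 hφ)
    simp only [h1]
    rw [← Finset.sum_filter, Finset.sum_const, nsmul_eq_mul, Nat.card_eq_fintype_card,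
      Fintype.card_subtype]
  -- The number of bases is `∏ (Q^(m+1) - Q^i)`, which could vanish in `𝕜`; `hQi` rules this out.
  have hbases : (Nat.card {φ : Fin (m + 1) → T // LinearIndependent F φ} : 𝕜) ≠ 0 := by
    rw [card_linearIndependent (K := F) (V := T) hTdim.ge, hTdim, Nat.cast_prod]
    refine Finset.prod_ne_zero_iff.2 fun i _ => ?_
    have hi := i.2
    rw [Nat.cast_sub (Nat.pow_le_pow_right Fintype.card_pos hi.le), Nat.cast_pow, Nat.cast_pow,
      ← hQdef, show Q ^ (m + 1) = Q ^ i.1 * Q ^ (m + 1 - i.1) by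
        rw [← pow_add, Nat.add_sub_cancel' hi.le], ← mul_sub_one]
    exact mul_ne_zero (pow_ne_zero _ hQ) (sub_ne_zero.2 (hQi _ (by omega) (by omega)))
  -- The sums over `t`-tuples are combinations of `(Q^e)^t` with `1 ≤ e ≤ m + 1`, so the
  -- coefficients of `P` give a linear recurrence that they satisfy. The terms with `t ≤ m` vanish
  -- and `P` is monic, so the term `t = m + 1` vanishes too.
  set P : 𝕜[X] := ∏ e ∈ Finset.range (m + 1), (X - C (Q ^ (e + 1))) with hP
  have hPmonic : P.Monic := monic_prod_X_sub_C _ _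
  have hPdeg : P.natDegree = m + 1 := by
    rw [hP, natDegree_prod_of_monic _ _ fun e _ => monic_X_sub_C _]
    simp only [natDegree_X_sub_C, Finset.sum_const, Finset.card_range, smul_eq_mul, mul_one]
  have hPeval : ∀ e, 1 ≤ e → e ≤ m + 1 → P.eval (Q ^ e) = 0 := by
    intro e he1 he2
    rw [hP, eval_prod]
    refine Finset.prod_eq_zero (i := e - 1) (Finset.mem_range.2 (by omega)) ?_
    rw [Nat.sub_add_cancel he1]
    simp
  have hsum : ∑ t ∈ Finset.range (m + 2),
      P.coeff t * ∑ φ : Fin t → T, sumBelow c (commonKernel φ) = 0 := by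
    simp only [sum_sumBelow_commonKernel, Finset.mul_sum]
    rw [Finset.sum_comm]
    refine Finset.sum_eq_zero fun W _ => ?_
    split_ifs with hWE
    · rcases Nat.lt_or_ge m (finrank F W) with hW | hW
      · simp [hc W hW]
      · set S := (W.comap E.subtype).dualAnnihilator.comap T.subtype
        have h1 : 1 ≤ finrank F S := one_le_finrank_comap_dualAnnihilator (by omega)
        have h2 : finrank F S ≤ m + 1 := hTdim ▸ S.finrank_le
        have h3 := hPeval _ h1 h2
        rw [eval_eq_sum_range' (by omega : P.natDegree < m + 2)] at h3
        have h4 : (Nat.card S : 𝕜) = Q ^ finrank F S := by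
          rw [natCard_eq_card_pow_finrank F S, Nat.cast_pow]
        rw [h4]
        calc _ = c W * ∑ i ∈ Finset.range (m + 2), P.coeff i * (Q ^ finrank F S) ^ i := by
              rw [Finset.mul_sum]
              exact Finset.sum_congr rfl fun i _ => by ring
          _ = 0 := by rw [h3, mul_zero]
    · simp
  rw [Finset.sum_range_succ, Finset.sum_eq_zero fun t ht => by
    rw [hsmall t (Finset.mem_range.1 ht), mul_zero], zero_add, hlarge, ← hPdeg,
    hPmonic.coeff_natDegree, one_mul, hPdeg] at hsum
  exact (mul_eq_zero.1 hsum).resolve_left hbases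

/-- A combination of the functions `B ↦ [W ≤ B]` which vanishes on the subspaces of dimension at
most `m` in the support is trivial. -/
theorem eq_zero_of_sumBelow_eq_zero [FiniteDimensional F V] [Fintype (Submodule F V)]
    {c : Submodule F V → 𝕜} (h : ∀ B, c B ≠ 0 → sumBelow c B = 0) : c = 0 := by
  classical
  by_contra hne
  obtain ⟨W₀, hW₀⟩ := Function.ne_iff.1 hne
  obtain ⟨B, hB, hmin⟩ := exists_minimal_of_wellFoundedLT (fun W => c W ≠ 0) ⟨W₀, hW₀⟩
  refine hB ?_
  rw [← h B hB, sumBelow, Finset.sum_eq_single B]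
  · simp
  · intro W _ hWB
    split_ifs with hle
    · by_contra hW
      exact hWB (le_antisymm hle (hmin hW hle))
    · rfl
  · simp

/-- A combination of the functions `B ↦ [W ≤ B]` with `dim W ≤ m` which vanishes on `m + 1`
consecutive dimensions is trivial. -/
theorem eq_zero_of_sumBelow_eq_zero_of_consecutive [Fintype F] [FiniteDimensional F V]
    [Fintype (Submodule F V)] {m d : ℕ} (hQ : (Fintype.card F : 𝕜) ≠ 0)
    (hQi : ∀ i, 1 ≤ i → i ≤ m + 1 → (Fintype.card F : 𝕜) ^ i ≠ 1)
    {c : Submodule F V → 𝕜} (hc : ∀ W : Submodule F V, m < finrank F W → c W = 0) (hd : d + m ≤ finrank F V)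
    (h : ∀ B : Submodule F V, d ≤ finrank F B → finrank F B ≤ d + m → sumBelow c B = 0) :
    c = 0 := by
  have hdown : ∀ d, d + m ≤ finrank F V →
      (∀ B : Submodule F V, d ≤ finrank F B → finrank F B ≤ d + m → sumBelow c B = 0) →
      ∀ B : Submodule F V, finrank F B ≤ d + m → sumBelow c B = 0 := by
    intro d
    induction d with
    | zero => exact fun _ h B hB => h B (Nat.zero_le _) hB
    | succ d ih =>
      intro hd h B hB
      have hd' : ∀ D : Submodule F V, finrank F D = d → sumBelow c D = 0 := fun D hD =>
        sumBelow_eq_zero_of_above hQ hQi hc (by omega)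
          fun B hB1 hB2 => h B (by omega) (by omega)
      rcases Nat.lt_or_ge (finrank F B) (d + 1) with hB1 | hB1
      · refine ih (by omega) (fun B hB2 hB3 => ?_) B (by omega)
        rcases hB2.eq_or_lt with hB2 | hB2
        · exact hd' B hB2.symm
        · exact h B hB2 (by omega)
      · exact h B hB1 hB
  -- The support of `c` lies in dimensions at most `m ≤ d + m`, all reached by the descent.
  refine eq_zero_of_sumBelow_eq_zero fun B hB => hdown d hd h B ?_
  by_contra hlt
  exact hB (hc B (by omega))

end Descent

/-! ### The linear algebra bound -/

section DimensionBound

open Module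

variable {F V 𝕜 : Type*} [Field F] [AddCommGroup V] [Module F V] [Field 𝕜]

/-- The function `B ↦ [W ≤ B]` on subspaces. -/
noncomputable def containsIndicator (𝕜 : Type*) [Field 𝕜] (W : Submodule F V) :
    Submodule F V → 𝕜 :=
  open scoped Classical in fun B => if W ≤ B then 1 else 0

/-- The functions on subspaces spanned by the `containsIndicator 𝕜 W` with `dim W ≤ s`. -/
def degreeLE (F V 𝕜 : Type*) [Field F] [AddCommGroup V] [Module F V] [Field 𝕜] (s : ℕ) :
    Submodule 𝕜 (Submodule F V → 𝕜) :=
  Submodule.span 𝕜 (containsIndicator 𝕜 '' {W : Submodule F V | finrank F W ≤ s})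

theorem containsIndicator_mem_degreeLE {W : Submodule F V} {s : ℕ} (h : finrank F W ≤ s) :
    containsIndicator 𝕜 W ∈ degreeLE F V 𝕜 s :=
  Submodule.subset_span ⟨W, h, rfl⟩

theorem one_mem_degreeLE : (1 : Submodule F V → 𝕜) ∈ degreeLE F V 𝕜 0 := by
  have : containsIndicator 𝕜 (⊥ : Submodule F V) = 1 := by
    funext B
    simp [containsIndicator]
  rw [← this]
  exact containsIndicator_mem_degreeLE (by simp)

theorem finrank_degreeLE_le [Fintype (Submodule F V)] (s : ℕ) :
    finrank 𝕜 (degreeLE F V 𝕜 s) ≤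
      (Finset.univ.filter fun W : Submodule F V => finrank F W ≤ s).card := by
  classical
  have h : (containsIndicator 𝕜 '' {W : Submodule F V | finrank F W ≤ s}) =
      ((Finset.univ.filter fun W : Submodule F V => finrank F W ≤ s).image
        (containsIndicator 𝕜) : Finset (Submodule F V → 𝕜)) := by
    ext f
    simp
  rw [degreeLE, h]
  exact (finrank_span_finset_le_card _).trans Finset.card_image_le

theorem card_pow_finrank_inf [Fintype F] [FiniteDimensional F V] [Fintype V]
    (A B : Submodule F V) :
    (Fintype.card F : 𝕜) ^ finrank F (A ⊓ B : Submodule F V) =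
      open scoped Classical in
      ∑ v ∈ Finset.univ.filter (· ∈ A), containsIndicator 𝕜 (Submodule.span F {v}) B := by
  classical
  rw [← Nat.cast_pow, ← natCard_eq_card_pow_finrank F (A ⊓ B : Submodule F V),
    Nat.card_eq_fintype_card, Fintype.card_subtype]
  simp only [containsIndicator, Submodule.span_singleton_le_iff_mem]
  rw [← Finset.sum_filter, Finset.sum_const, nsmul_one, Finset.filter_filter]
  simp only [Submodule.mem_inf]

/-- The power of `q` is a sum of indicators of the spans of vectors `v ∈ A`. Multiplying `[W ≤ B]`
by such an indicator gives `[span v ⊔ W ≤ B]`, raising the dimension by at most one. -/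
theorem mul_mem_degreeLE_succ [Fintype F] [FiniteDimensional F V] (A : Submodule F V) (a : 𝕜)
    {s : ℕ} {f : Submodule F V → 𝕜} (hf : f ∈ degreeLE F V 𝕜 s) :
    (fun B => ((Fintype.card F : 𝕜) ^ finrank F (A ⊓ B : Submodule F V) - a) * f B) ∈
      degreeLE F V 𝕜 (s + 1) := by
  classical
  have : Finite V := Module.finite_of_finite F
  have : Fintype V := Fintype.ofFinite V
  set M : (Submodule F V → 𝕜) →ₗ[𝕜] (Submodule F V → 𝕜) := LinearMap.mulLeft 𝕜
    (fun B => (Fintype.card F : 𝕜) ^ finrank F (A ⊓ B : Submodule F V) - a) with hM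
  suffices h : degreeLE F V 𝕜 s ≤ (degreeLE F V 𝕜 (s + 1)).comap M from h hf
  refine Submodule.span_le.2 ?_
  rintro _ ⟨W, hW, rfl⟩
  have hW : finrank F W ≤ s := hW
  have heq : M (containsIndicator 𝕜 W) =
      ∑ v ∈ Finset.univ.filter (· ∈ A), containsIndicator 𝕜 (Submodule.span F {v} ⊔ W) -
        a • containsIndicator 𝕜 W := by
    funext B
    simp only [hM, LinearMap.mulLeft_apply, Pi.mul_apply, Pi.sub_apply, Finset.sum_apply,
      Pi.smul_apply, smul_eq_mul, card_pow_finrank_inf, sub_mul, Finset.sum_mul]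
    congr 1
    refine Finset.sum_congr rfl fun v _ => ?_
    simp only [containsIndicator, sup_le_iff]
    split_ifs <;> simp_all
  change M (containsIndicator 𝕜 W) ∈ degreeLE F V 𝕜 (s + 1)
  rw [heq]
  refine Submodule.sub_mem _ (Submodule.sum_mem _ fun v _ => ?_)
    (Submodule.smul_mem _ _ (containsIndicator_mem_degreeLE (by omega)))
  refine containsIndicator_mem_degreeLE ?_
  have h1 := Submodule.finrank_add_le_finrank_add_finrank (Submodule.span F {v}) W
  have h2 : finrank F (Submodule.span F {v}) ≤ 1 :=
    (finrank_span_le_card ({v} : Set V)).trans (by simp)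
  omega

theorem prod_mul_mem_degreeLE [Fintype F] [FiniteDimensional F V] (A : Submodule F V)
    (a : ℕ → 𝕜) (S : Finset ℕ) {s : ℕ} {f : Submodule F V → 𝕜} (hf : f ∈ degreeLE F V 𝕜 s) :
    (fun B => (∏ i ∈ S, ((Fintype.card F : 𝕜) ^ finrank F (A ⊓ B : Submodule F V) - a i)) * f B) ∈
      degreeLE F V 𝕜 (s + S.card) := by
  induction S using Finset.induction_on with
  | empty => simpa using hf
  | insert i S hi ih =>
    simp only [Finset.prod_insert hi, Finset.card_insert_of_notMem hi, mul_assoc]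
    exact mul_mem_degreeLE_succ A (a i) ih

/-- The dimension bound: functions attached to the members of the family `𝓕`, together with
multiples of `containsIndicator 𝕜 W` for `W ∈ 𝓦` which vanish on `𝓕`, are linearly independent. -/
theorem card_add_card_le [Fintype F] [FiniteDimensional F V] [Fintype (Submodule F V)]
    {𝓕 𝓦 : Finset (Submodule F V)} {K L : Finset ℕ} {a : ℕ → 𝕜}
    (hdiag : ∀ A ∈ 𝓕, ∏ i ∈ L, ((Fintype.card F : 𝕜) ^ finrank F A - a i) ≠ 0)
    (hoff : ∀ A ∈ 𝓕, ∀ B ∈ 𝓕, A ≠ B →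
      ∏ i ∈ L, ((Fintype.card F : 𝕜) ^ finrank F (A ⊓ B : Submodule F V) - a i) = 0)
    (hvan : ∀ A ∈ 𝓕, ∏ i ∈ K, ((Fintype.card F : 𝕜) ^ finrank F A - a i) = 0)
    (hdeg : ∀ W ∈ 𝓦, finrank F W + K.card ≤ L.card)
    (hind : ∀ c : Submodule F V → 𝕜, (∀ W, W ∉ 𝓦 → c W = 0) →
      (∀ B : Submodule F V, ∏ i ∈ K, ((Fintype.card F : 𝕜) ^ finrank F B - a i) ≠ 0 →
        sumBelow c B = 0) → c = 0) :
    𝓕.card + 𝓦.card ≤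
      (Finset.univ.filter fun W : Submodule F V => finrank F W ≤ L.card).card := by
  classical
  set Q : 𝕜 := (Fintype.card F : 𝕜)
  let v : 𝓕 ⊕ 𝓦 → Submodule F V → 𝕜 := Sum.elim
    (fun A B => ∏ i ∈ L, (Q ^ finrank F (A.1 ⊓ B : Submodule F V) - a i))
    (fun W B => (∏ i ∈ K, (Q ^ finrank F B - a i)) * containsIndicator 𝕜 W.1 B)
  have hmem : ∀ x, v x ∈ degreeLE F V 𝕜 L.card := by
    rintro (A | W)
    · have h := prod_mul_mem_degreeLE (𝕜 := 𝕜) A.1 a L (one_mem_degreeLE (F := F) (V := V))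
      simp only [Pi.one_apply, mul_one, zero_add] at h
      exact h
    · have h := prod_mul_mem_degreeLE ⊤ a K
        (containsIndicator_mem_degreeLE (𝕜 := 𝕜) (Nat.le_sub_of_add_le (hdeg W.1 W.2)))
      have hKL : K.card ≤ L.card := (Nat.le_add_left _ _).trans (hdeg W.1 W.2)
      have htop : ∀ B : Submodule F V, finrank F (⊤ ⊓ B : Submodule F V) = finrank F B :=
        fun B => by rw [top_inf_eq]
      simp only [htop, Nat.sub_add_cancel hKL] at h
      exact h
  have hli : LinearIndependent 𝕜 v := by
    rw [Fintype.linearIndependent_iff]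
    intro x hx
    have hxB : ∀ B, ∑ A : 𝓕, x (Sum.inl A) *
          ∏ i ∈ L, (Q ^ finrank F (A.1 ⊓ B : Submodule F V) - a i) +
        (∏ i ∈ K, (Q ^ finrank F B - a i)) *
          ∑ W : 𝓦, x (Sum.inr W) * containsIndicator 𝕜 W.1 B = 0 := by
      intro B
      have h := congrFun hx B
      rw [Fintype.sum_sum_type, Pi.add_apply, Finset.sum_apply, Finset.sum_apply] at h
      rw [Finset.mul_sum]
      refine Eq.trans ?_ h
      congr 1
      refine Finset.sum_congr rfl fun W _ => ?_
      simp only [v, Sum.elim_inr, Pi.smul_apply, smul_eq_mul]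
      ring
    -- Evaluating at a member of `𝓕` kills the second block and every off-diagonal term of the
    -- first.
    have hinl : ∀ A : 𝓕, x (Sum.inl A) = 0 := by
      intro A
      have h := hxB A.1
      rw [hvan A.1 A.2, zero_mul, add_zero, Finset.sum_eq_single A, inf_idem] at h
      · exact (mul_eq_zero.1 h).resolve_right (hdiag A.1 A.2)
      · intro A' _ hne
        rw [hoff A'.1 A'.2 A.1 A.2 (Subtype.coe_injective.ne hne), mul_zero]
      · simp
    have hc := hind (fun W => if h : W ∈ 𝓦 then x (Sum.inr ⟨W, h⟩) else 0)
      (fun W hW => dif_neg hW) (fun B hB => by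
        have h := hxB B
        simp only [hinl, zero_mul, Finset.sum_const_zero, zero_add] at h
        refine Eq.trans ?_ ((mul_eq_zero.1 h).resolve_left hB)
        rw [sumBelow, ← Finset.sum_subset (Finset.subset_univ 𝓦) (fun W _ hW => by simp [hW]),
          ← Finset.sum_coe_sort]
        refine Finset.sum_congr rfl fun W _ => ?_
        simp [containsIndicator])
    rintro (A | W)
    · exact hinl A
    · simpa using congrFun hc W.1
  calc 𝓕.card + 𝓦.card = Fintype.card (𝓕 ⊕ 𝓦) := by simp
    _ = finrank 𝕜 (Submodule.span 𝕜 (Set.range v)) := (finrank_span_eq_card hli).symm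
    _ ≤ finrank 𝕜 (degreeLE F V 𝕜 L.card) :=
      Submodule.finrank_mono (Submodule.span_le.2 (Set.range_subset_iff.2 hmem))
    _ ≤ _ := finrank_degreeLE_le _

end DimensionBound

/-! ### Gaps in a set of residues -/

/-- If `r` residues modulo `b` satisfy `r (m + 1) < b`, then one of them is followed by `m + 1`
consecutive residues outside the set. -/
theorem exists_gap {K : Finset ℕ} {b m : ℕ} (hK : K ⊆ Finset.range b) (hKne : K.Nonempty)
    (hb : K.card * (m + 1) < b) :
    ∃ k ∈ K, ∀ j, 1 ≤ j → j ≤ m + 1 → (k + j) % b ∉ K := by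
  set S := (K ×ˢ Finset.range (m + 1)).image fun x => (x.1 + x.2) % b with hS
  have hScard : S.card < (Finset.range b).card := by
    refine lt_of_le_of_lt Finset.card_image_le ?_
    rwa [Finset.card_product, Finset.card_range, Finset.card_range]
  obtain ⟨x, hxb, hxS⟩ := Finset.exists_mem_notMem_of_card_lt_card hScard
  have hxb := Finset.mem_range.1 hxb
  -- Walk back from the uncovered residue `x` to the nearest element of `K`; adding `b` avoids
  -- truncated subtraction. The distance is at least `m + 1`, as otherwise `x` would be covered.
  have hex : ∃ j, j ≤ x + b ∧ (x + b - j) % b ∈ K := by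
    obtain ⟨k, hk⟩ := hKne
    have hkb := Finset.mem_range.1 (hK hk)
    refine ⟨x + b - k, Nat.sub_le _ _, ?_⟩
    rwa [Nat.sub_sub_self (by omega), Nat.mod_eq_of_lt hkb]
  classical
  obtain ⟨hj1, hj2⟩ := Nat.find_spec hex
  have hjmin : ∀ j < Nat.find hex, ¬ _ := fun j => Nat.find_min hex
  set j₀ := Nat.find hex
  have hj₀ : m + 1 ≤ j₀ := by
    by_contra hlt
    refine hxS (Finset.mem_image.2 ⟨((x + b - j₀) % b, j₀), ?_, ?_⟩)
    · exact Finset.mem_product.2 ⟨hj2, Finset.mem_range.2 (by simpa using hlt)⟩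
    · rw [Nat.mod_add_mod, Nat.sub_add_cancel hj1, Nat.add_mod_right, Nat.mod_eq_of_lt hxb]
  refine ⟨_, hj2, fun j hj hjm hmem => hjmin (j₀ - j) (by omega) ⟨by omega, ?_⟩⟩
  rwa [Nat.mod_add_mod, show x + b - j₀ + j = x + b - (j₀ - j) by omega] at hmem

/-! ### Assembling the bounds -/

section Main

open Module

variable {F V : Type*} [Field F] [Fintype F] [AddCommGroup V] [Module F V]
  [FiniteDimensional F V] [Fintype (Submodule F V)]

theorem cast_card_filter_finrank_eq (d : ℕ) :
    ((Finset.univ.filter fun W : Submodule F V => finrank F W = d).card : ℚ) =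
      qBinom (Fintype.card F) (finrank F V) d := by
  rw [← natCard_finrank_eq, ← Fintype.card_subtype, Nat.card_eq_fintype_card]

theorem cast_card_filter_finrank_mem (K : Finset ℕ) :
    ((Finset.univ.filter fun W : Submodule F V => finrank F W ∈ K).card : ℚ) =
      ∑ k ∈ K, qBinom (Fintype.card F) (finrank F V) k := by
  rw [Finset.card_eq_sum_card_fiberwise (f := fun W : Submodule F V => finrank F W) (t := K)
    (fun W hW => by simpa using hW), Nat.cast_sum]
  refine Finset.sum_congr rfl fun k hk => ?_
  rw [← cast_card_filter_finrank_eq, Finset.filter_filter]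
  congr 2
  ext W
  simp only [Finset.mem_filter, Finset.mem_univ, true_and]
  exact ⟨fun h => h.2, fun h => ⟨h ▸ hk, h⟩⟩

theorem cast_card_filter_finrank_Ioc (s r : ℕ) :
    ((Finset.univ.filter fun W : Submodule F V =>
      finrank F W ≤ s ∧ s < finrank F W + r).card : ℚ) =
      sumN (finrank F V) s r (Fintype.card F) := by
  rw [Finset.card_eq_sum_card_fiberwise (f := fun W : Submodule F V => s - finrank F W)
    (t := Finset.range r) (fun W hW => by
      simp only [Finset.coe_filter, Finset.mem_univ, true_and, Set.mem_ofPred_eq] at hW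
      simp only [Finset.coe_range, Set.mem_Iio]
      omega), Nat.cast_sum, sumN]
  refine Finset.sum_congr rfl fun i hi => ?_
  have hi := Finset.mem_range.1 hi
  rw [Finset.filter_filter]
  rcases Nat.lt_or_ge s i with hsi | hsi
  · rw [qBinom, if_neg (by omega), Finset.filter_false_of_mem fun W _ => by omega]
    simp
  · rw [← Int.ofNat_sub hsi, ← cast_card_filter_finrank_eq]
    congr 2
    ext W
    simp only [Finset.mem_filter, Finset.mem_univ, true_and]
    omega

/-- The family together with a set `𝓦` of small subspaces is bounded by the number of subspaces of
dimension at most `s`, given independence of the functions attached to `𝓦`. -/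
theorem card_add_card_le_of_modEq {𝕜 : Type*} [Field 𝕜] {b : ℕ} (hb : b ≠ 0)
    (hprim : IsPrimitiveRoot (Fintype.card F : 𝕜) b) {K L : Finset ℕ}
    (hK : K ⊆ Finset.range b) (hL : L ⊆ Finset.range b) (hKL : Disjoint K L)
    {𝓕 𝓦 : Finset (Submodule F V)}
    (hdim : ∀ A ∈ 𝓕, ∃ k ∈ K, finrank F A ≡ k [MOD b])
    (hinter : ∀ A ∈ 𝓕, ∀ B ∈ 𝓕, A ≠ B →
      ∃ μ ∈ L, finrank F (A ⊓ B : Submodule F V) ≡ μ [MOD b])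
    (hdeg : ∀ W ∈ 𝓦, finrank F W + K.card ≤ L.card)
    (hind : ∀ c : Submodule F V → 𝕜, (∀ W, W ∉ 𝓦 → c W = 0) →
      (∀ B : Submodule F V, finrank F B % b ∉ K → sumBelow c B = 0) → c = 0) :
    𝓕.card + 𝓦.card ≤
      (Finset.univ.filter fun W : Submodule F V => finrank F W ≤ L.card).card := by
  have hpow : ∀ i j : ℕ, (Fintype.card F : 𝕜) ^ i - (Fintype.card F : 𝕜) ^ j = 0 ↔
      i ≡ j [MOD b] := by
    intro i j
    rw [sub_eq_zero, (hprim.isOfFinOrder hb).pow_eq_pow_iff_modEq, ← hprim.eq_orderOf]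
  refine card_add_card_le (a := fun i => (Fintype.card F : 𝕜) ^ i) (K := K) ?_ ?_ ?_ hdeg ?_
  · intro A hA
    obtain ⟨k, hk, hAk⟩ := hdim A hA
    refine Finset.prod_ne_zero_iff.2 fun μ hμ h => ?_
    have h1 : k % b = μ % b := hAk.symm.trans ((hpow _ _).1 h)
    rw [Nat.mod_eq_of_lt (Finset.mem_range.1 (hK hk)),
      Nat.mod_eq_of_lt (Finset.mem_range.1 (hL hμ))] at h1
    exact Finset.disjoint_left.1 hKL hk (h1 ▸ hμ)
  · intro A hA B hB hAB
    obtain ⟨μ, hμ, h⟩ := hinter A hA B hB hAB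
    exact Finset.prod_eq_zero hμ ((hpow _ _).2 h)
  · intro A hA
    obtain ⟨k, hk, h⟩ := hdim A hA
    exact Finset.prod_eq_zero hk ((hpow _ _).2 h)
  · intro c hc hB
    refine hind c hc fun B hBK => hB B (Finset.prod_ne_zero_iff.2 fun k hk h => hBK ?_)
    have h1 : finrank F B % b = k % b := (hpow _ _).1 h
    rw [Nat.mod_eq_of_lt (Finset.mem_range.1 (hK hk))] at h1
    rwa [h1]

end Main

theorem mainTheorem1 {F V : Type*} [Field F] [Fintype F] [AddCommGroup V] [Module F V]
    [FiniteDimensional F V] (n q b r s : ℕ)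
    (hn : Module.finrank F V = n) (hq : Fintype.card F = q)
    (K L : Finset ℕ) (hKne : K.Nonempty)
    (hK : K ⊆ Finset.range b) (hL : L ⊆ Finset.range b) (hKL : Disjoint K L)
    (hr : K.card = r) (hs : L.card = s)
    (𝓕 : Finset (Submodule F V))
    (hdim : ∀ A ∈ 𝓕, ∃ k ∈ K, Module.finrank F A ≡ k [MOD b])
    (hinter : ∀ A ∈ 𝓕, ∀ B ∈ 𝓕, A ≠ B →
      ∃ μ ∈ L, Module.finrank F (A ⊓ B : Submodule F V) ≡ μ [MOD b])
    (hexc₁ : ¬ ((∃ a : ℕ, q + 1 = 2 ^ a) ∧ b = 2))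
    (hexc₂ : ¬ (q = 2 ∧ b = 6)) :
    (((s + K.max' hKne ≤ n ∧ (r : ℤ) * ((s : ℤ) - r + 1) ≤ (b : ℤ) - 1) ∨
        s < K.min' hKne + r) →
      (𝓕.card : ℚ) ≤ sumN n s r q) ∧
    (¬ ((s + K.max' hKne ≤ n ∧ (r : ℤ) * ((s : ℤ) - r + 1) ≤ (b : ℤ) - 1) ∨
        s < K.min' hKne + r) →
      (𝓕.card : ℚ) ≤ sumN n s r q + ∑ k ∈ K, qBinom q n (k : ℤ)) := by
  classical
  have : Finite V := Module.finite_of_finite F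
  have : Fintype (Submodule F V) := Fintype.ofFinite _
  subst hn hq
  rw [← cast_card_filter_finrank_Ioc, ← cast_card_filter_finrank_mem (F := F) (V := V) K]
  have hrpos : 0 < r := hr ▸ hKne.card_pos
  have hsum : s + r ≤ b := by
    rw [← hs, ← hr, add_comm, ← Finset.card_union_of_disjoint hKL]
    simpa using Finset.card_le_card (Finset.union_subset hK hL)
  rcases Nat.lt_or_ge b 2 with hb2 | hb2
  -- Zsigmondy's theorem needs `b ≥ 2`. Here `r ≥ 1` and `s + r ≤ b` leave `L` empty, so `𝓕` has at
  -- most one member.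
  · have hs0 : s = 0 := by omega
    subst hs0
    have h1 : 𝓕.card ≤ 1 := Finset.card_le_one.2 fun A hA B hB => by
      by_contra hAB
      obtain ⟨μ, hμ, -⟩ := hinter A hA B hB hAB
      rw [Finset.card_eq_zero.1 hs] at hμ
      simp at hμ
    have h2 : 1 ≤ (Finset.univ.filter fun W : Submodule F V =>
        Module.finrank F W ≤ 0 ∧ 0 < Module.finrank F W + r).card :=
      Finset.card_pos.2 ⟨⊥, by simp [hrpos]⟩
    exact ⟨fun _ => by exact_mod_cast h1.trans h2,
      fun _ => by exact_mod_cast (h1.trans h2).trans (Nat.le_add_right _ _)⟩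
  obtain ⟨p, hp, hprim⟩ := exists_prime_isPrimitiveRoot
    (q := Fintype.card F) Fintype.one_lt_card hb2 hexc₁ hexc₂
  have : Fact p.Prime := ⟨hp⟩
  have key := fun 𝓦 => card_add_card_le_of_modEq (𝓕 := 𝓕) (𝓦 := 𝓦) (by omega) hprim hK hL hKL
    hdim hinter
  rw [hr, hs] at key
  have hall : ∀ W : Submodule F V, Module.finrank F W + r ≤ s →
      Module.finrank F W % b = Module.finrank F W := fun W hW => Nat.mod_eq_of_lt (by omega)
  have htri : ∀ 𝓦 : Finset (Submodule F V),
      (∀ W ∈ 𝓦, Module.finrank F W + r ≤ s ∧ Module.finrank F W ∉ K) →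
      𝓕.card + 𝓦.card ≤
        (Finset.univ.filter fun W : Submodule F V => Module.finrank F W ≤ s).card := by
    intro 𝓦 h𝓦
    refine key 𝓦 (fun W hW => (h𝓦 W hW).1) fun c hc hB => ?_
    refine eq_zero_of_sumBelow_eq_zero fun B hcB => hB B ?_
    have h := h𝓦 B (by_contra fun h => hcB (hc B h))
    rw [hall B h.1]
    exact h.2
  constructor
  · intro hcase
    set 𝓦 := Finset.univ.filter fun W : Submodule F V => Module.finrank F W + r ≤ s with h𝓦
    suffices h : 𝓕.card + 𝓦.card ≤
        (Finset.univ.filter fun W : Submodule F V => Module.finrank F W ≤ s).card by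
      have hle : (Finset.univ.filter fun W : Submodule F V => Module.finrank F W ≤ s).card ≤
          (Finset.univ.filter fun W : Submodule F V =>
            Module.finrank F W ≤ s ∧ s < Module.finrank F W + r).card + 𝓦.card := by
        refine (Finset.card_le_card fun W hW => ?_).trans (Finset.card_union_le _ _)
        simp only [h𝓦, Finset.mem_union, Finset.mem_filter, Finset.mem_univ, true_and] at hW ⊢
        omega
      exact_mod_cast (by omega)
    by_cases hlt : s < K.min' hKne + r
    · refine htri 𝓦 fun W hW => ?_
      have hW : Module.finrank F W + r ≤ s := (Finset.mem_filter.1 hW).2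
      exact ⟨hW, fun hmem => by have := K.min'_le _ hmem; omega⟩
    · obtain ⟨hmax, hrs⟩ := hcase.resolve_right hlt
      obtain ⟨m, rfl⟩ : ∃ m, s = m + r := ⟨s - r, by omega⟩
      have hrm : r * (m + 1) < b := by
        have h : (r : ℤ) * (m + 1) < b := by
          push_cast at hrs
          rw [add_sub_cancel_right] at hrs
          omega
        exact_mod_cast h
      have hmb : m + 1 < b := lt_of_le_of_lt (Nat.le_mul_of_pos_left _ hrpos) hrm
      obtain ⟨k, hk, hgap⟩ := exists_gap hK hKne (hr ▸ hrm)
      have hkmax := K.le_max' k hk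
      refine key 𝓦 (fun W hW => (Finset.mem_filter.1 hW).2) fun c hc hB => ?_
      -- The gap occupies dimensions `k + 1, …, k + m + 1`, which fit in `V` because `k + m + 1 ≤
      -- k_r + s ≤ n`. Also `m + 1 < b` keeps `q^i ≠ 1` in the required range.
      refine eq_zero_of_sumBelow_eq_zero_of_consecutive (m := m) (d := k + 1)
        (hprim.ne_zero (by omega)) (fun i hi1 hi2 => hprim.pow_ne_one_of_pos_of_lt (by omega)
          (by omega)) (fun W hW => hc W fun h => ?_) (by omega) (fun B hB1 hB2 => hB B ?_)
      · have := (Finset.mem_filter.1 h).2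
        omega
      · have h := hgap (Module.finrank F B - k) (by omega) (by omega)
        rwa [Nat.add_sub_cancel' (by omega)] at h
  · intro _
    -- Only the `W` with dimension outside `K` are used; the omitted ones are counted by the
    -- subspaces with dimension in `K`.
    have h := htri (Finset.univ.filter fun W : Submodule F V =>
      Module.finrank F W + r ≤ s ∧ Module.finrank F W ∉ K) fun W hW => (Finset.mem_filter.1 hW).2
    have hle : (Finset.univ.filter fun W : Submodule F V => Module.finrank F W ≤ s).card ≤
        ((Finset.univ.filter fun W : Submodule F V =>
            Module.finrank F W ≤ s ∧ s < Module.finrank F W + r).card +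
          (Finset.univ.filter fun W : Submodule F V => Module.finrank F W ∈ K).card) +
        (Finset.univ.filter fun W : Submodule F V =>
          Module.finrank F W + r ≤ s ∧ Module.finrank F W ∉ K).card := by
      refine (Finset.card_le_card fun W hW => ?_).trans ((Finset.card_union_le _ _).trans
        (Nat.add_le_add_right (Finset.card_union_le _ _) _))
      simp only [Finset.mem_union, Finset.mem_filter, Finset.mem_univ, true_and] at hW ⊢
      by_cases hWK : Module.finrank F W ∈ K
      · exact Or.inl (Or.inr hWK)
      · simp only [hWK, not_false_eq_true, and_true, or_false]
        omega
    exact_mod_cast (by omega)
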